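/- Let $\mathfrak g$ be a finite-dimensional simple complex Lie algebra with Cartan subalgebra $\mathfrak h$, that is, $\mathfrak g=\operatorname{Lie}(G)_{\mathbb C}$ and $\mathfrak h=\mathfrak t_{\mathbb C}$ for a simple, simply connected, compact Lie group $G$ and the Lie algebra $\mathfrak t$ of a maximal torus of $G$. Let $\Delta\subset\mathfrak h^*$ be the set of roots, $h_\alpha\in\mathfrak h$ the coroot of $\alpha\in\Delta$, $\mathfrak h_{\mathbb R}$ the real span of the coroots, and $\mathfrak t=i\,\mathfrak h_{\mathbb R}$, with its topology as a finite-dimensional real vector space. Fix a positive system $\Delta^+\subset\Delta$, with simple roots $\alpha_1,\dots,\alpha_n$ and highest root $\alpha_0$. Let $W$ be the Weyl group, generated by the reflections $t\mapsto t-\alpha(t)h_\alpha$ of $\mathfrak t$ ($\alpha\in\Delta$), let $R^\vee$ be the integer span of the coroots, and let the affine Weyl group $\widehat W$ be the group generated by the maps $t\mapsto wt+z$ of $\mathfrak t$ with $w\in W$ and $z\in 2\pi i R^\vee$ (the kernel of $\exp\colon\mathfrak t\to G$). The alcove walls are the hyperplanes $\{t\in\mathfrak t\mid\alpha(t)=2\pi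 i m\}$ with $\alpha\in\Delta$, $m\in\mathbb Z$. Let $\overline{A}_0$ be the closure of the fundamental alcove $$A_0=\{iH\in\mathfrak t\mid 0<\alpha(H)<2\pi\text{ for all }\alpha\in\Delta^+\}.$$ Put $v_0=0$, and for $1\le k\le n$ let $v_k\in\mathfrak t$ be determined by $\alpha_0(v_k)=2\pi i$ and $\alpha_j(v_k)=0$ for $1\le j\le n$, $j\ne k$. Put $$F_0=\{iH\in\mathfrak t\mid \alpha_0(H)=2\pi,\ \alpha_j(H)\ge 0\text{ for }1\le j\le n\}$$ and, for $1\le k\le n$, $$F_k=\{iH\in\mathfrak t\mid \alpha_0(H)\le 2\pi,\ \alpha_j(H)\ge 0\text{ for }1\le j\le n,\ j\ne k,\ \alpha_k(H)=0\}.$$ For $0\le k\le n$ let $\widehat W_k=\{w\in\widehat W\mid w(v_k)=v_k\}$ and $C_k=\bigcup_{w\in\widehat W_k}w\bigl(\overline{A}_0\setminus F_k\bigr)$. Then: (a) For each $0\le k\le n$, $C_k$ is an open subset of $\mathfrak t$, contains $v_k$, and is star-shaped with respect to $v_k$ (so it contracts to $v_k$ along straight lines). (b) For each $0\le k\le n$,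 every alcove wall that meets $C_k$ contains $v_k$. (c) For each $0\le k\le n$, if $u_1,u_2\in C_k$ and $u_2=w(u_1)$ for some $w\in\widehat W$, then $w(v_k)=v_k$. (d) $\overline{A}_0\subseteq\bigcup_{k=0}^{n}C_k$. -/

import Mathlib

open Set

namespace AffineWeyl

noncomputable section

/-! ### Alcove geometry of a real root system

`P` is a root system of linear functionals on the real vector space `V`. A point `x` of `V` stands
for the point `i x` of the Lie algebra `𝔱 = i V` of the maximal torus, so that the condition
`α(i x) ∈ 2πiℤ` reads `α(x) ∈ 2πℤ`. -/

section RootSystem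

variable {ι M V : Type*} [AddCommGroup M] [Module ℝ M] [AddCommGroup V] [Module ℝ V]
  (P : RootPairing ι ℝ M V)

/-- The Weyl group acting on `V`: the group generated by the reflections `x ↦ x - α(x) h_α`. -/
def weylGroup : Subgroup (V ≃ₗ[ℝ] V) :=
  Subgroup.closure (range P.coreflection)

/-- The coroot lattice `R^∨`, the integer span of the coroots. -/
def corootLattice : AddSubgroup V :=
  AddSubgroup.closure (range P.coroot)

/-- The affine Weyl group: the group of transformations of `V` that is generated by the maps
`x ↦ w x + 2π z` with `w` in the Weyl group and `z` in the coroot lattice. -/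
def affineWeylGroup : Subgroup (V ≃ᵃ[ℝ] V) :=
  Subgroup.closure {g | ∃ w ∈ weylGroup P, ∃ z ∈ corootLattice P,
    ∀ x, g x = w x + (2 * Real.pi) • z}

/-- The alcove wall `{x | α(x) = 2πm}` of the root `α = P.root i` and the integer `m`. -/
def wall (i : ι) (m : ℤ) : Set V :=
  {x | P.root' i x = 2 * Real.pi * m}

variable {P}

/-- The open fundamental alcove: `0 < α(x) < 2π` for every positive root `α`. -/
def fundamentalAlcove (b : P.Base) : Set V :=
  {x | ∀ i, P.root i ∈ AddSubmonoid.closure (P.root '' b.support) →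
    0 < P.root' i x ∧ P.root' i x < 2 * Real.pi}

/-- `θ` is (the index of) the highest root: every difference `P.root θ - α`, with `α` a root,
is a sum of simple roots. -/
def IsHighestRoot (b : P.Base) (θ : ι) : Prop :=
  ∀ i, P.root θ - P.root i ∈ AddSubmonoid.closure (P.root '' b.support)

/-- The defining equations of the vertices `v₀, …, vₙ`. The index `0` is `none`, and the indices
`1, …, n` of the simple roots are the elements of `b.support`: one has `v₀ = 0`, and for every
simple root `αₖ` one has `θ(vₖ) = 2π` and `αⱼ(vₖ) = 0` for all simple roots `αⱼ` with `j ≠ k`. -/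
structure IsVertices (b : P.Base) (θ : ι) (v : Option b.support → V) : Prop where
  zero : v none = 0
  highest (k : b.support) : P.root' θ (v (some k)) = 2 * Real.pi
  simple (k j : b.support) : j ≠ k → P.root' j (v (some k)) = 0

/-- The face `Fₖ` of the closed fundamental alcove, opposite to `vₖ`. -/
def face (b : P.Base) (θ : ι) : Option b.support → Set V
  | none => {x | P.root' θ x = 2 * Real.pi ∧ ∀ j ∈ b.support, 0 ≤ P.root' j x}
  | some k => {x | P.root' θ x ≤ 2 * Real.pi ∧
      (∀ j ∈ b.support, j ≠ k → 0 ≤ P.root' j x) ∧ P.root' k x = 0}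

/-- The cell `Cₖ`: the union of the images of (closed fundamental alcove) `\ Fₖ` under the
stabilizer of `vₖ` in the affine Weyl group. -/
def cell [TopologicalSpace V] (b : P.Base) (θ : ι) (v : Option b.support → V)
    (k : Option b.support) : Set V :=
  ⋃ w ∈ {w ∈ affineWeylGroup P | w (v k) = v k},
    w '' (closure (fundamentalAlcove b) \ face b θ k)

end RootSystem

/-! ### The root system of a simple complex Lie algebra -/

section Lie

open LieAlgebra

variable {𝔤 : Type*} [LieRing 𝔤] [LieAlgebra ℂ 𝔤] [FiniteDimensional ℂ 𝔤] [IsSimple ℂ 𝔤]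
  (𝔥 : LieSubalgebra ℂ 𝔤) [𝔥.IsCartanSubalgebra]

/-- The real form `𝔥_ℝ` of the Cartan subalgebra, the real span of the coroots `h_α`. -/
abbrev realCartan : Submodule ℝ 𝔥 :=
  Submodule.span ℝ (range (IsKilling.rootSystem 𝔥).coroot)

/-- The roots of `𝔤` with respect to `𝔥`, as a root system on the real vector space `𝔥_ℝ`. -/
abbrev realRootSystem : RootPairing 𝔥.root ℝ
    (Submodule.span ℝ (range (IsKilling.rootSystem 𝔥).root)) (realCartan 𝔥) :=
  (IsKilling.rootSystem 𝔥).restrictScalars ℝ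

end Lie

end

end AffineWeyl

namespace AffineWeyl

section RootSystem

variable {ι M V : Type*} [AddCommGroup M] [Module ℝ M] [AddCommGroup V] [Module ℝ V]
  {P : RootPairing ι ℝ M V}

/-! ### Affine reflections -/

/-! The key fact is `cell_eq_openStar`: the cell of a vertex is its open star, the set of points
strictly on the vertex's side of every wall that misses the vertex. An open star is a finite
intersection of open strips, hence open and convex, and it meets only walls through the vertex; this
gives (a) and (b). For (d), no point lies on all the faces: every simple root would vanish there,
while the highest root would equal `2π`.

A point of the closed alcove off the `k`-th face lies in the star of `v k`, because that face spans
the only wall of the alcove missing `v k`; the stabilizer of `v k` permutes walls and so preserves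
the star. Conversely, a point of the star is folded into the closed alcove: in its finite orbit
under the stabilizer, take a point nearest, for `P.CorootForm`, to an interior point `c` of the
alcove. A wall through `v k` separating the two would give a reflection bringing it closer.

For (c), the affine Weyl group acts freely on alcoves (`eq_one_of_mem_fundamentalAlcove`): it is
generated by the reflections in the walls of one alcove (`affineWeylGroup_le_closure`), each of
which crosses only its own wall, so the exchange condition shortens every nonempty word returning to
the alcove. Perturbing the given point into the interior of an alcove then writes `w` as a product
of elements fixing `v k`. -/

lemma affineEquiv_mul_apply (g h : V ≃ᵃ[ℝ] V) (x : V) : (g * h) x = g (h x) := rfl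

/-- The translation `x ↦ x + 2π z`. -/
noncomputable def translation (z : V) : V ≃ᵃ[ℝ] V :=
  AffineEquiv.constVAdd ℝ V ((2 * Real.pi) • z)

@[simp] lemma translation_apply (z x : V) : translation z x = x + (2 * Real.pi) • z := by
  simp [translation, add_comm]

lemma translation_add (y z : V) : translation (y + z) = translation y * translation z := by
  ext x
  simp only [translation_apply, affineEquiv_mul_apply]
  module

lemma translation_zero : translation (0 : V) = 1 := by
  ext x; simp

lemma translation_neg (z : V) : translation (-z) = (translation z)⁻¹ := by
  rw [eq_inv_iff_mul_eq_one, ← translation_add, neg_add_cancel, translation_zero]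

variable (P) in
/-- The reflection in the wall `α(x) = 2πm`. -/
noncomputable def affineReflection (i : ι) (m : ℤ) : V ≃ᵃ[ℝ] V :=
  translation (m • P.coroot i) * (P.coreflection i).toAffineEquiv

@[simp] lemma affineReflection_apply (i : ι) (m : ℤ) (x : V) :
    affineReflection P i m x = x - (P.root' i x - 2 * Real.pi * m) • P.coroot i := by
  simp only [affineReflection, affineEquiv_mul_apply, LinearEquiv.coe_toAffineEquiv,
    P.coreflection_apply, translation_apply]
  module

lemma root'_affineReflection (i j : ι) (m : ℤ) (x : V) :
    P.root' j (affineReflection P i m x) =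
      P.root' j x - (P.root' i x - 2 * Real.pi * m) * P.pairing j i := by
  simp

lemma root'_affineReflection_self (i : ι) (m : ℤ) (x : V) :
    P.root' i (affineReflection P i m x) = 4 * Real.pi * m - P.root' i x := by
  rw [root'_affineReflection, P.pairing_same]
  ring

lemma affineReflection_mul_self (i : ι) (m : ℤ) :
    affineReflection P i m * affineReflection P i m = 1 := by
  ext x
  rw [affineEquiv_mul_apply, affineReflection_apply (x := affineReflection P i m x),
    root'_affineReflection_self i m, affineReflection_apply]
  simp only [AffineEquiv.coe_one, id_eq]
  module

lemma affineReflection_inv (i : ι) (m : ℤ) :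
    (affineReflection P i m)⁻¹ = affineReflection P i m :=
  inv_eq_of_mul_eq_one_left (affineReflection_mul_self i m)

lemma root'_reflectionPerm (i j : ι) (x : V) :
    P.root' (P.reflectionPerm i j) x = P.root' j x - P.pairing j i * P.root' i x := by
  simp [RootPairing.root', P.root_reflectionPerm, P.reflection_apply_root]

lemma root'_reflectionPerm_self (i : ι) (x : V) :
    P.root' (P.reflectionPerm i i) x = -P.root' i x := by
  rw [root'_reflectionPerm, P.pairing_same]
  ring

lemma affineReflection_reflectionPerm_self (i : ι) (m : ℤ) :
    affineReflection P (P.reflectionPerm i i) m = affineReflection P i (-m) := by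
  ext x
  rw [affineReflection_apply, affineReflection_apply, root'_reflectionPerm_self,
    P.coroot_reflectionPerm, P.coreflection_apply_self]
  push_cast
  module

lemma affineReflection_zero (i : ι) :
    affineReflection P i 0 = (P.coreflection i).toAffineEquiv := by
  rw [affineReflection, zero_smul, translation_zero, one_mul]

lemma affineReflection_one (i : ι) :
    affineReflection P i 1 = translation (P.coroot i) * affineReflection P i 0 := by
  rw [affineReflection_zero, affineReflection, one_smul]

lemma affineReflection_mem (i : ι) (m : ℤ) : affineReflection P i m ∈ affineWeylGroup P := by
  refine Subgroup.subset_closure ⟨P.coreflection i, Subgroup.subset_closure (mem_range_self i),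
    m • P.coroot i, zsmul_mem (AddSubgroup.subset_closure (mem_range_self i)) _, fun x ↦ ?_⟩
  simp [affineReflection]

/-! ### Transformations permuting the affine roots -/

variable (P) in
/-- The transformation `g` permutes the affine roots `α - 2πm`, and its linear part permutes the
coroots accordingly. -/
def PermutesAffineRoots (g : V ≃ᵃ[ℝ] V) : Prop :=
  ∀ (i : ι) (m : ℤ), ∃ (j : ι) (n : ℤ),
    (∀ x, P.root' i (g x) - 2 * Real.pi * m = P.root' j x - 2 * Real.pi * n) ∧
    g.linear (P.coroot j) = P.coroot i

lemma PermutesAffineRoots.one : PermutesAffineRoots P 1 :=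
  fun i m ↦ ⟨i, m, fun _ ↦ rfl, rfl⟩

lemma PermutesAffineRoots.mul {g h : V ≃ᵃ[ℝ] V} (hg : PermutesAffineRoots P g)
    (hh : PermutesAffineRoots P h) : PermutesAffineRoots P (g * h) := by
  intro i m
  obtain ⟨j, n, h₁, h₂⟩ := hg i m
  obtain ⟨k, l, h₃, h₄⟩ := hh j n
  refine ⟨k, l, fun x ↦ ?_, ?_⟩
  · rw [affineEquiv_mul_apply, h₁, h₃]
  · rw [← h₂, ← h₄]; rfl

lemma affineReflection_linear (i : ι) (m : ℤ) :
    (affineReflection P i m).linear = P.coreflection i := by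
  rfl

lemma permutesAffineRoots_affineReflection [P.IsCrystallographic] (i : ι) (m : ℤ) :
    PermutesAffineRoots P (affineReflection P i m) := by
  intro j n
  refine ⟨P.reflectionPerm i j, n - m * P.pairingIn ℤ j i, fun x ↦ ?_, ?_⟩
  · have : (P.pairingIn ℤ j i : ℝ) = P.pairing j i := by
      simpa using P.algebraMap_pairingIn ℤ j i
    rw [root'_affineReflection, root'_reflectionPerm]
    push_cast
    rw [this]
    ring
  · rw [affineReflection_linear, P.coroot_reflectionPerm, P.coreflection_same]

/-- Conjugation by `g` carries the reflection in a pulled-back wall to the reflection in the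
original one; this is the use of the coroot clause in `PermutesAffineRoots`. -/
lemma mul_affineReflection_comm {g : V ≃ᵃ[ℝ] V} {i j : ι} {m n : ℤ}
    (h₁ : ∀ x, P.root' i (g x) - 2 * Real.pi * m = P.root' j x - 2 * Real.pi * n)
    (h₂ : g.linear (P.coroot j) = P.coroot i) :
    g * affineReflection P j n = affineReflection P i m * g := by
  ext x
  rw [affineEquiv_mul_apply, affineEquiv_mul_apply, affineReflection_apply,
    affineReflection_apply, h₁, ← h₂, sub_eq_neg_add x, ← vadd_eq_add, AffineEquiv.map_vadd, map_neg,
    map_smul, vadd_eq_add, neg_add_eq_sub]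

/-! ### The fundamental alcove -/

lemma toLinearMap_apply_nonneg {b : P.Base} {a : M}
    (ha : a ∈ AddSubmonoid.closure (P.root '' b.support)) {x : V}
    (hx : ∀ j ∈ b.support, 0 ≤ P.root' j x) : 0 ≤ P.toLinearMap a x := by
  induction ha using AddSubmonoid.closure_induction with
  | mem a h =>
    obtain ⟨j, hj, rfl⟩ := h
    exact hx j hj
  | zero => simp
  | add a a' _ _ h h' =>
    rw [map_add, LinearMap.add_apply]
    exact add_nonneg h h'

lemma eq_zero_or_toLinearMap_apply_pos {b : P.Base} {a : M}
    (ha : a ∈ AddSubmonoid.closure (P.root '' b.support)) {x : V}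
    (hx : ∀ j ∈ b.support, 0 < P.root' j x) : a = 0 ∨ 0 < P.toLinearMap a x := by
  induction ha using AddSubmonoid.closure_induction with
  | mem a h =>
    obtain ⟨j, hj, rfl⟩ := h
    exact .inr (hx j hj)
  | zero => simp
  | add a a' _ _ h h' =>
    rw [map_add, LinearMap.add_apply]
    rcases h with rfl | h
    · simpa using h'
    · rcases h' with rfl | h'
      · simp [h]
      · exact .inr (add_pos h h')

lemma root'_pos {b : P.Base} {i : ι} (hi : P.root i ∈ AddSubmonoid.closure (P.root '' b.support))
    {x : V} (hx : ∀ j ∈ b.support, 0 < P.root' j x) : 0 < P.root' i x :=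
  (eq_zero_or_toLinearMap_apply_pos hi hx).resolve_left (P.ne_zero i)

lemma root_mem_or_reflectionPerm_mem (b : P.Base) (i : ι) :
    P.root i ∈ AddSubmonoid.closure (P.root '' b.support) ∨
      P.root (P.reflectionPerm i i) ∈ AddSubmonoid.closure (P.root '' b.support) := by
  rw [P.root_reflectionPerm, P.reflection_apply_self]
  exact b.root_mem_or_neg_mem i

lemma isPos_of_root_mem {b : P.Base} {i : ι}
    (hi : P.root i ∈ AddSubmonoid.closure (P.root '' b.support)) : b.IsPos i := by
  rw [← Submodule.span_nat_eq_addSubmonoidClosure, Submodule.mem_toAddSubmonoid,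
    Submodule.mem_span_image_finset_iff_exists_fun] at hi
  obtain ⟨f, hf⟩ := hi
  classical
  rw [b.isPos_iff', b.height_eq_sum
    -- Nonnegative coefficients give nonnegative height; the value `0` off `b.support` never enters
    -- the sum.
    (f := fun j ↦ if h : j ∈ b.support then (f ⟨j, h⟩ : ℤ) else 0)
    (by rw [← Finset.sum_coe_sort]; simp [← hf])]
  exact Finset.sum_nonneg fun j hj ↦ by simp [hj]

lemma root_mem_iff_isPos {b : P.Base} {i : ι} :
    P.root i ∈ AddSubmonoid.closure (P.root '' b.support) ↔ b.IsPos i := by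
  refine ⟨isPos_of_root_mem, fun h ↦ ?_⟩
  refine (root_mem_or_reflectionPerm_mem b i).resolve_right fun h' ↦ ?_
  exact (RootPairing.Base.IsPos.neg_iff_not b i).1 (isPos_of_root_mem h') h

/-! ### Consequences of the highest root -/

namespace IsHighestRoot

variable {b : P.Base} {θ : ι}

lemma root_mem (hθ : IsHighestRoot b θ) :
    P.root θ ∈ AddSubmonoid.closure (P.root '' b.support) := by
  have : Nonempty ι := ⟨θ⟩
  obtain ⟨j, hj⟩ := b.support_nonempty
  rw [← sub_add_cancel (P.root θ) (P.root j)]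
  exact add_mem (hθ j) (AddSubmonoid.subset_closure (mem_image_of_mem _ hj))

lemma le (hθ : IsHighestRoot b θ) {x : V} (hx : ∀ j ∈ b.support, 0 ≤ P.root' j x) (i : ι) :
    P.root' i x ≤ P.root' θ x := by
  have := toLinearMap_apply_nonneg (hθ i) hx
  rwa [map_sub, LinearMap.sub_apply, sub_nonneg] at this

lemma lt (hθ : IsHighestRoot b θ) {x : V} (hx : ∀ j ∈ b.support, 0 < P.root' j x) {i : ι}
    (hi : i ≠ θ) : P.root' i x < P.root' θ x := by
  have := (eq_zero_or_toLinearMap_apply_pos (hθ i) hx).resolve_left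
    (sub_ne_zero.2 fun h ↦ hi (P.root.injective h.symm))
  rwa [map_sub, LinearMap.sub_apply, sub_pos] at this

lemma mem_fundamentalAlcove_iff (hθ : IsHighestRoot b θ) {x : V} :
    x ∈ fundamentalAlcove b ↔
      (∀ j ∈ b.support, 0 < P.root' j x) ∧ P.root' θ x < 2 * Real.pi := by
  refine ⟨fun h ↦ ⟨fun j hj ↦ (h j (AddSubmonoid.subset_closure (mem_image_of_mem _ hj))).1,
    (h θ hθ.root_mem).2⟩, fun h i hi ↦ ⟨root'_pos hi h.1, ?_⟩⟩
  exact (hθ.le (fun j hj ↦ (h.1 j hj).le) i).trans_lt h.2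

/-- At the dominant point `c` every root takes a value between `-θ(c)` and `θ(c)`. Applied to the
reflected root `α - pθ`, with `0 < α(c) < θ(c)`, this forces `-1 < p < 2`. -/
lemma pairingIn_eq_zero_or_one [P.IsCrystallographic] (hθ : IsHighestRoot b θ) {c : V}
    (hc : ∀ j ∈ b.support, 0 < P.root' j c) {i : ι}
    (hi : P.root i ∈ AddSubmonoid.closure (P.root '' b.support)) (hne : i ≠ θ) :
    P.pairingIn ℤ i θ = 0 ∨ P.pairingIn ℤ i θ = 1 := by
  set p := P.pairingIn ℤ i θ
  have hp : P.pairing i θ = p := by simpa using (P.algebraMap_pairingIn ℤ i θ).symm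
  have h₀ := root'_pos hi hc
  have h₁ := hθ.lt hc hne
  have hc' : ∀ j ∈ b.support, 0 ≤ P.root' j c := fun j hj ↦ (hc j hj).le
  have h₂ := hθ.le hc' (P.reflectionPerm θ i)
  have h₃ := hθ.le hc' (P.reflectionPerm (P.reflectionPerm θ i) (P.reflectionPerm θ i))
  rw [root'_reflectionPerm_self, root'_reflectionPerm, hp] at h₃
  rw [root'_reflectionPerm, hp] at h₂
  have h₄ : (p : ℝ) < 2 := by nlinarith
  have h₅ : (-1 : ℝ) < p := by nlinarith
  norm_cast at h₄ h₅
  lia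

end IsHighestRoot

/-! ### Walls separating points of alcoves -/

lemma sub_ne_zero_of_mem_fundamentalAlcove {b : P.Base} {x : V} (hx : x ∈ fundamentalAlcove b)
    (i : ι) (m : ℤ) : P.root' i x - 2 * Real.pi * m ≠ 0 := by
  have hπ := Real.pi_pos
  wlog hi : P.root i ∈ AddSubmonoid.closure (P.root '' b.support) generalizing i m
  · have := this (P.reflectionPerm i i) (-m) ((root_mem_or_reflectionPerm_mem b i).resolve_left hi)
    rw [root'_reflectionPerm_self] at this
    push_cast at this
    contrapose! this
    linarith
  obtain ⟨h₁, h₂⟩ := hx i hi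
  intro h
  rcases le_or_gt m 0 with hm | hm
  · have : (m : ℝ) ≤ 0 := by exact_mod_cast hm
    nlinarith
  · have : (1 : ℝ) ≤ m := by exact_mod_cast hm
    nlinarith

lemma mul_pos_of_mem_Ioo {r s : ℝ} (hr : r ∈ Ioo 0 (2 * Real.pi)) (hs : s ∈ Ioo 0 (2 * Real.pi))
    (m : ℤ) : 0 < (r - 2 * Real.pi * m) * (s - 2 * Real.pi * m) := by
  have hπ := Real.pi_pos
  obtain ⟨hr₁, hr₂⟩ := hr
  obtain ⟨hs₁, hs₂⟩ := hs
  rcases le_or_gt m 0 with hm | hm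
  · have : (m : ℝ) ≤ 0 := by exact_mod_cast hm
    exact mul_pos (by nlinarith) (by nlinarith)
  · have : (1 : ℝ) ≤ m := by exact_mod_cast hm
    exact mul_pos_of_neg_of_neg (by nlinarith) (by nlinarith)

lemma mul_pos_of_mem_fundamentalAlcove {b : P.Base} {x y : V} (hx : x ∈ fundamentalAlcove b)
    (hy : y ∈ fundamentalAlcove b) (i : ι) (m : ℤ) :
    0 < (P.root' i x - 2 * Real.pi * m) * (P.root' i y - 2 * Real.pi * m) := by
  wlog hi : P.root i ∈ AddSubmonoid.closure (P.root '' b.support) generalizing i m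
  · have := this (P.reflectionPerm i i) (-m) ((root_mem_or_reflectionPerm_mem b i).resolve_left hi)
    rw [root'_reflectionPerm_self, root'_reflectionPerm_self] at this
    push_cast at this
    linarith
  exact mul_pos_of_mem_Ioo (hx i hi) (hy i hi) m

/-- The reflections in the walls of the fundamental alcove. -/
def simpleReflections (b : P.Base) (θ : ι) : Set (V ≃ᵃ[ℝ] V) :=
  insert (affineReflection P θ 1) ((fun j ↦ affineReflection P j 0) '' b.support)

lemma exists_eq_affineReflection_of_mem_simpleReflections {b : P.Base} {θ : ι} {s : V ≃ᵃ[ℝ] V}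
    (hs : s ∈ simpleReflections b θ) : ∃ i m, s = affineReflection P i m := by
  rcases hs with rfl | ⟨j, -, rfl⟩
  exacts [⟨θ, 1, rfl⟩, ⟨j, 0, rfl⟩]

/-- The only wall separating the fundamental alcove from its image under a simple reflection is
the wall of this reflection. -/
lemma affineReflection_eq_of_separates [Finite ι] [P.IsCrystallographic] [P.IsReduced]
    {b : P.Base} {θ : ι} (hθ : IsHighestRoot b θ) {c : V} (hc : c ∈ fundamentalAlcove b)
    {s : V ≃ᵃ[ℝ] V} (hs : s ∈ simpleReflections b θ) (i : ι) (m : ℤ)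
    (h : (P.root' i c - 2 * Real.pi * m) * (P.root' i (s c) - 2 * Real.pi * m) < 0) :
    affineReflection P i m = s := by
  have hπ := Real.pi_pos
  wlog hi : P.root i ∈ AddSubmonoid.closure (P.root '' b.support) generalizing i m
  · have := this (P.reflectionPerm i i) (-m) (by
      rw [root'_reflectionPerm_self, root'_reflectionPerm_self]
      push_cast
      linarith) ((root_mem_or_reflectionPerm_mem b i).resolve_left hi)
    rwa [affineReflection_reflectionPerm_self, neg_neg] at this
  have hci := hc i hi
  have hc' := hθ.mem_fundamentalAlcove_iff.1 hc
  -- A positive root whose value at `s c` stays in `(0, 2π)` has no separating wall, so each root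
  -- other than that of `s` is excluded by showing exactly this.
  have key : P.root' i (s c) ∉ Ioo 0 (2 * Real.pi) := fun h' ↦
    (mul_pos_of_mem_Ioo hci h' m).not_gt h
  rcases hs with rfl | ⟨j, hj, rfl⟩
  · rcases eq_or_ne i θ with rfl | hne
    · rw [root'_affineReflection_self] at h
      push_cast at h
      -- The values of the highest root at `c` and `s c` are symmetric about `2π` and lie in `(0,
      -- 4π)`, so `2π` is the only multiple of `2π` between them.
      obtain rfl : m = 1 := by
        rcases lt_trichotomy m 1 with hm | hm | hm
        · have : (m : ℝ) ≤ 0 := by exact_mod_cast Int.lt_add_one_iff.1 hm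
          nlinarith [mul_nonneg (show 0 ≤ P.root' i c - 2 * Real.pi * m by nlinarith)
            (show 0 ≤ 4 * Real.pi * 1 - P.root' i c - 2 * Real.pi * m by nlinarith)]
        · exact hm
        · have : (2 : ℝ) ≤ m := by exact_mod_cast hm
          nlinarith [mul_nonneg (show 0 ≤ 2 * Real.pi * m - P.root' i c by nlinarith)
            (show 0 ≤ 2 * Real.pi * m - (4 * Real.pi * 1 - P.root' i c) by nlinarith)]
      rfl
    · have hp : P.pairing i θ = P.pairingIn ℤ i θ := by
        simpa using (P.algebraMap_pairingIn ℤ i θ).symm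
      have hlt := hθ.lt hc'.1 hne
      refine (key ?_).elim
      rw [root'_affineReflection, hp]
      rcases hθ.pairingIn_eq_zero_or_one hc'.1 hi hne with h₀ | h₀
      · simpa [h₀] using hci
      · rw [h₀]
        constructor <;> push_cast <;> linarith [hci.1, hci.2, hc'.2]
  · rcases eq_or_ne i j with rfl | hne
    · dsimp only at h
      rw [root'_affineReflection_self] at h
      push_cast at h
      obtain rfl : m = 0 := by
        rcases lt_trichotomy m 0 with hm | hm | hm
        · have : (m : ℝ) ≤ -1 := by exact_mod_cast Int.le_sub_one_of_lt hm
          nlinarith [mul_nonneg (show 0 ≤ P.root' i c - 2 * Real.pi * m by nlinarith [hci.1])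
            (show 0 ≤ 4 * Real.pi * 0 - P.root' i c - 2 * Real.pi * m by nlinarith [hci.2])]
        · exact hm
        · have : (1 : ℝ) ≤ m := by exact_mod_cast hm
          nlinarith [mul_nonneg (show 0 ≤ 2 * Real.pi * m - P.root' i c by nlinarith [hci.2])
            (show 0 ≤ 2 * Real.pi * m - (4 * Real.pi * 0 - P.root' i c) by nlinarith [hci.1])]
      rfl
    -- A simple reflection permutes the positive roots other than its own.
    · have := root_mem_iff_isPos.2 ((isPos_of_root_mem hi).reflectionPerm hj hne)
      refine (key ?_).elim
      have h' := hc _ this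
      rw [root'_reflectionPerm] at h'
      dsimp only
      rw [root'_affineReflection]
      push_cast
      rw [mul_zero, sub_zero, mul_comm (P.root' j c)]
      exact h'

lemma permutesAffineRoots_list_prod [P.IsCrystallographic] {b : P.Base} {θ : ι}
    {l : List (V ≃ᵃ[ℝ] V)} (hl : ∀ s ∈ l, s ∈ simpleReflections b θ) :
    PermutesAffineRoots P l.prod := by
  induction l with
  | nil => exact .one
  | cons s l ih =>
    rw [List.prod_cons]
    obtain ⟨i, m, rfl⟩ := exists_eq_affineReflection_of_mem_simpleReflections (hl s (by simp))
    exact (permutesAffineRoots_affineReflection i m).mul (ih fun t ht ↦ hl t (by simp [ht]))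

/-- The exchange condition. -/
lemma exists_list_prod_eq_affineReflection_mul [Finite ι] [P.IsCrystallographic] [P.IsReduced]
    {b : P.Base} {θ : ι} (hθ : IsHighestRoot b θ) {c : V} (hc : c ∈ fundamentalAlcove b)
    (i : ι) (m : ℤ) (l : List (V ≃ᵃ[ℝ] V)) (hl : ∀ s ∈ l, s ∈ simpleReflections b θ)
    (h : (P.root' i c - 2 * Real.pi * m) * (P.root' i (l.prod c) - 2 * Real.pi * m) < 0) :
    ∃ l' : List (V ≃ᵃ[ℝ] V), (∀ s ∈ l', s ∈ simpleReflections b θ) ∧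
      l'.length + 1 = l.length ∧ l.prod = affineReflection P i m * l'.prod := by
  induction l using List.reverseRecOn with
  | nil => exact absurd h (mul_self_nonneg _).not_gt
  | append_singleton l s ih =>
    have hl' : ∀ t ∈ l, t ∈ simpleReflections b θ := fun t ht ↦ hl t (by simp [ht])
    obtain ⟨j, n, h₁, h₂⟩ := permutesAffineRoots_list_prod hl' i m
    rw [List.prod_append, List.prod_singleton] at h ⊢
    -- Either the wall is crossed before the last letter, or its pullback by `l.prod` separates `c`
    -- from `s c` and is therefore the wall of `s`, which can be deleted.
    rcases lt_or_ge ((P.root' i c - 2 * Real.pi * m) *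
      (P.root' i (l.prod c) - 2 * Real.pi * m)) 0 with h' | h'
    · obtain ⟨l', hl₁, hl₂, hl₃⟩ := ih hl' h'
      refine ⟨l' ++ [s], fun t ht ↦ ?_, by simp [hl₂], by simp [hl₃, mul_assoc]⟩
      rcases List.mem_append.1 ht with ht | ht
      exacts [hl₁ t ht, hl t (by simp_all)]
    · refine ⟨l, hl', by simp, ?_⟩
      rw [h₁] at h'
      rw [affineEquiv_mul_apply, h₁] at h
      have h₃ := sub_ne_zero_of_mem_fundamentalAlcove hc j n
      have h₄ : affineReflection P j n = s := by
        refine affineReflection_eq_of_separates hθ hc (hl s (by simp)) j n ?_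
        rcases lt_or_gt_of_ne h₃ with h₃ | h₃
        · exact mul_neg_of_neg_of_pos h₃ (by nlinarith)
        · exact mul_neg_of_pos_of_neg h₃ (by nlinarith)
      rw [← h₄, mul_affineReflection_comm h₁ h₂]

lemma list_prod_eq_one_of_mem_fundamentalAlcove [Finite ι] [P.IsCrystallographic] [P.IsReduced]
    {b : P.Base} {θ : ι} (hθ : IsHighestRoot b θ) {c : V} (hc : c ∈ fundamentalAlcove b)
    (l : List (V ≃ᵃ[ℝ] V)) (hl : ∀ s ∈ l, s ∈ simpleReflections b θ)
    (h : l.prod c ∈ fundamentalAlcove b) : l.prod = 1 := by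
  induction hn : l.length using Nat.strong_induction_on generalizing l with
  | _ n ih =>
    cases l with
    | nil => rfl
    | cons s l =>
      obtain ⟨i, m, rfl⟩ := exists_eq_affineReflection_of_mem_simpleReflections (hl s (by simp))
      have hl' : ∀ t ∈ l, t ∈ simpleReflections b θ := fun t ht ↦ hl t (by simp [ht])
      -- The whole word does not cross the wall of its first letter, so the tail does; exchanging in
      -- the tail cancels that letter and leaves a word shorter by two.
      have h₁ := mul_pos_of_mem_fundamentalAlcove hc h i m
      rw [List.prod_cons, affineEquiv_mul_apply, root'_affineReflection_self] at h₁
      obtain ⟨l', hl₁, hl₂, hl₃⟩ :=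
        exists_list_prod_eq_affineReflection_mul hθ hc i m l hl' (by linarith)
      have h₂ : (affineReflection P i m :: l).prod = l'.prod := by
        rw [List.prod_cons, hl₃, ← mul_assoc, affineReflection_mul_self, one_mul]
      rw [h₂] at h ⊢
      refine ih l'.length ?_ l' hl₁ h rfl
      rw [List.length_cons] at hn
      lia

/-! ### The affine Weyl group is generated by the simple reflections -/

lemma conj_translation_affineReflection_zero (i : ι) (z : V) :
    affineReflection P i 0 * translation z * affineReflection P i 0 =
      translation (P.coreflection i z) := by
  ext x
  simp only [affineReflection_zero, affineEquiv_mul_apply, LinearEquiv.coe_toAffineEquiv,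
    translation_apply, map_add, map_smul, P.coreflection_same]

lemma conj_affineReflection_zero (i j : ι) :
    affineReflection P i 0 * affineReflection P j 0 * affineReflection P i 0 =
      affineReflection P (P.reflectionPerm i j) 0 := by
  ext x
  simp only [affineReflection_zero, affineEquiv_mul_apply, LinearEquiv.coe_toAffineEquiv]
  simp only [P.coreflection_apply, root'_reflectionPerm, P.coroot_reflectionPerm, map_sub, map_smul,
    P.root'_coroot_eq_pairing, P.pairing_same, smul_eq_mul]
  module

/-- Every root arises from simple ones by simple reflections and sign changes, and reflections are
conjugated accordingly. -/
lemma affineReflection_zero_mem_closure [Finite ι] [P.IsCrystallographic] [P.IsReduced]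
    (b : P.Base) (θ i : ι) :
    affineReflection P i 0 ∈ Subgroup.closure (simpleReflections b θ) := by
  have h : ∀ j ∈ b.support, affineReflection P j 0 ∈ Subgroup.closure (simpleReflections b θ) :=
    fun j hj ↦ Subgroup.subset_closure (.inr ⟨j, hj, rfl⟩)
  induction i using b.induction_reflect with
  | h₀ i hi => rwa [affineReflection_reflectionPerm_self, neg_zero]
  | h₁ i hi => exact h i hi
  | h₂ i j hi hj =>
    rw [← conj_affineReflection_zero]
    exact mul_mem (mul_mem (h j hj) hi) (h j hj)

lemma translation_coreflection_mem_closure [Finite ι] [P.IsCrystallographic] [P.IsReduced]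
    {b : P.Base} {θ : ι} (i : ι) {z : V}
    (hz : translation z ∈ Subgroup.closure (simpleReflections b θ)) :
    translation (P.coreflection i z) ∈ Subgroup.closure (simpleReflections b θ) := by
  rw [← conj_translation_affineReflection_zero]
  have := affineReflection_zero_mem_closure b θ i
  exact mul_mem (mul_mem this hz) this

lemma translation_coroot_mem_closure [Finite ι] [P.IsCrystallographic] [P.IsReduced]
    {b : P.Base} {θ : ι} (hθ : IsHighestRoot b θ) {c : V} (hc : ∀ j ∈ b.support, 0 < P.root' j c)
    (i : ι) : translation (P.coroot i) ∈ Subgroup.closure (simpleReflections b θ) := by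
  set G := Subgroup.closure (simpleReflections b θ)
  by_contra hi
  have hθG : translation (P.coroot θ) ∈ G := by
    rw [← mul_inv_cancel_right (translation (P.coroot θ)) (affineReflection P θ 0),
      ← affineReflection_one, affineReflection_inv]
    exact mul_mem (Subgroup.subset_closure (.inl rfl)) (affineReflection_zero_mem_closure b θ θ)
  -- Take a counterexample with largest value at `c`. Counterexamples are stable under the Weyl
  -- group, so maximality makes this root positive and dominant; it then pairs positively with the
  -- highest root.
  obtain ⟨i, hi, hmax⟩ := exists_max_image {i | translation (P.coroot i) ∉ G}
    (fun i ↦ P.root' i c) (toFinite _) ⟨i, hi⟩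
  have hperm (j : ι) : translation (P.coroot (P.reflectionPerm j i)) ∉ G := fun h ↦ hi <| by
    rw [P.coroot_reflectionPerm] at h
    simpa using translation_coreflection_mem_closure j h
  have hipos : P.root i ∈ AddSubmonoid.closure (P.root '' b.support) := by
    refine (root_mem_or_reflectionPerm_mem b i).resolve_right fun h ↦ ?_
    have h₁ := root'_pos h hc
    have h₂ := hmax _ (hperm i)
    rw [root'_reflectionPerm_self] at h₁ h₂
    linarith
  have hdom (j : ι) (hj : j ∈ b.support) : 0 ≤ P.pairingIn ℤ j i := by
    have h₁ := hmax _ (hperm j)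
    rw [root'_reflectionPerm] at h₁
    have h₂ : 0 ≤ P.pairing i j := by
      by_contra! h
      nlinarith [hc j hj]
    rw [← P.algebraMap_pairingIn ℤ] at h₂
    have h₃ : 0 ≤ P.pairingIn ℤ i j := by simpa using h₂
    rcases h₃.lt_or_eq with h₃ | h₃
    · exact ((P.zero_lt_pairingIn_iff' ℤ).1 h₃).le
    · exact (P.pairingIn_eq_zero_iff.1 h₃.symm).ge
  have hcast (j : ι) : P.root' j (P.coroot i) = P.pairingIn ℤ j i := by
    simpa using (P.algebraMap_pairingIn ℤ j i).symm
  have hθi : 0 < P.pairingIn ℤ θ i := by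
    obtain ⟨j, hj, hj'⟩ := b.exists_mem_support_pos_pairingIn_ne_zero i
    have h₁ := hθ.le (x := P.coroot i)
      (fun j hj ↦ by rw [hcast]; exact_mod_cast hdom j hj) j
    rw [hcast, hcast] at h₁
    have h₂ := hdom j hj
    norm_cast at h₁
    lia
  have hp : P.pairingIn ℤ i θ = 1 :=
    (hθ.pairingIn_eq_zero_or_one hc hipos (by rintro rfl; exact hi hθG)).resolve_left
      ((P.zero_lt_pairingIn_iff' ℤ).1 hθi).ne'
  -- Since `p = 1`, reflecting the coroot of `θ` in the root `i` gives the difference of the two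
  -- coroots, so the translation by the coroot of `i` is also in `G`.
  have h₁ := translation_coreflection_mem_closure i hθG
  rw [P.coreflection_apply_coroot, ← P.algebraMap_pairingIn ℤ, hp, map_one, one_smul,
    sub_eq_add_neg, translation_add, Subgroup.mul_mem_cancel_left _ hθG, translation_neg,
    inv_mem_iff] at h₁
  exact hi h₁

lemma affineWeylGroup_le_closure [Finite ι] [P.IsCrystallographic] [P.IsReduced]
    {b : P.Base} {θ : ι} (hθ : IsHighestRoot b θ) {c : V} (hc : ∀ j ∈ b.support, 0 < P.root' j c) :
    affineWeylGroup P ≤ Subgroup.closure (simpleReflections b θ) := by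
  set G := Subgroup.closure (simpleReflections b θ)
  refine (Subgroup.closure_le _).2 ?_
  rintro g ⟨w, hw, z, hz, h⟩
  have hg : g = translation z * w.toAffineEquiv := by
    ext x
    simp [affineEquiv_mul_apply, h]
  rw [hg]
  clear hg h
  refine mul_mem ?_ ?_
  · induction hz using AddSubgroup.closure_induction with
    | mem z hz =>
      obtain ⟨i, rfl⟩ := hz
      exact translation_coroot_mem_closure hθ hc i
    | zero => rw [translation_zero]; exact one_mem _
    | add y z _ _ hy hz => rw [translation_add]; exact mul_mem hy hz
    | neg z _ hz => rw [translation_neg]; exact inv_mem hz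
  · induction hw using Subgroup.closure_induction with
    | mem w hw =>
      obtain ⟨i, rfl⟩ := hw
      rw [← affineReflection_zero]
      exact affineReflection_zero_mem_closure b θ i
    | one => exact one_mem G
    | mul v w _ _ hv hw => exact mul_mem hv hw
    | inv w _ hw => exact inv_mem hw

lemma exists_list_of_mem_affineWeylGroup [Finite ι] [P.IsCrystallographic] [P.IsReduced]
    {b : P.Base} {θ : ι} (hθ : IsHighestRoot b θ) {c : V} (hc : ∀ j ∈ b.support, 0 < P.root' j c)
    {w : V ≃ᵃ[ℝ] V} (hw : w ∈ affineWeylGroup P) :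
    ∃ l : List (V ≃ᵃ[ℝ] V), (∀ s ∈ l, s ∈ simpleReflections b θ) ∧ l.prod = w := by
  have h := affineWeylGroup_le_closure hθ hc hw
  rw [← Subgroup.mem_toSubmonoid, Subgroup.closure_toSubmonoid] at h
  obtain ⟨l, hl, rfl⟩ := Submonoid.exists_list_of_mem_closure h
  -- Simple reflections are involutions, so inverses add no letters.
  refine ⟨l, fun s hs ↦ (hl s hs).elim id fun h ↦ ?_, rfl⟩
  rw [Set.mem_inv] at h
  obtain ⟨i, m, h'⟩ := exists_eq_affineReflection_of_mem_simpleReflections h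
  rwa [← inv_inv s, h', affineReflection_inv, ← h']

/-- The affine Weyl group acts freely on the alcoves. -/
lemma eq_one_of_mem_fundamentalAlcove [Finite ι] [P.IsCrystallographic] [P.IsReduced]
    {b : P.Base} {θ : ι} (hθ : IsHighestRoot b θ) {w : V ≃ᵃ[ℝ] V} (hw : w ∈ affineWeylGroup P)
    {c : V} (hc : c ∈ fundamentalAlcove b) (hwc : w c ∈ fundamentalAlcove b) : w = 1 := by
  obtain ⟨l, hl, rfl⟩ :=
    exists_list_of_mem_affineWeylGroup hθ (hθ.mem_fundamentalAlcove_iff.1 hc).1 hw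
  exact list_prod_eq_one_of_mem_fundamentalAlcove hθ hc l hl hwc

lemma permutesAffineRoots_of_mem [Finite ι] [P.IsCrystallographic] [P.IsReduced]
    {b : P.Base} {θ : ι} (hθ : IsHighestRoot b θ) {c : V} (hc : ∀ j ∈ b.support, 0 < P.root' j c)
    {w : V ≃ᵃ[ℝ] V} (hw : w ∈ affineWeylGroup P) : PermutesAffineRoots P w := by
  obtain ⟨l, hl, rfl⟩ := exists_list_of_mem_affineWeylGroup hθ hc hw
  exact permutesAffineRoots_list_prod hl

/-! ### The open star of a point -/

variable (P) in
/-- The points that lie strictly on the same side as `u` of every wall not containing `u`. -/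
def openStar (u : V) : Set V :=
  {x | ∀ (i : ι) (m : ℤ), P.root' i u - 2 * Real.pi * m ≠ 0 →
    0 < (P.root' i x - 2 * Real.pi * m) * (P.root' i u - 2 * Real.pi * m)}

lemma self_mem_openStar (u : V) : u ∈ openStar P u := fun _ _ h ↦ mul_self_pos.2 h

lemma apply_mem_openStar_iff {g : V ≃ᵃ[ℝ] V} (hg : PermutesAffineRoots P g)
    (hg' : PermutesAffineRoots P g⁻¹) {u x : V} :
    g x ∈ openStar P (g u) ↔ x ∈ openStar P u := by
  have key {g : V ≃ᵃ[ℝ] V} (hg : PermutesAffineRoots P g) {u x : V} (hx : x ∈ openStar P u) :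
      g x ∈ openStar P (g u) := by
    intro i m h
    obtain ⟨j, n, hj, -⟩ := hg i m
    rw [hj] at h
    rw [hj, hj]
    exact hx j n h
  refine ⟨fun h ↦ ?_, key hg⟩
  have := key hg' h
  rwa [← affineEquiv_mul_apply, ← affineEquiv_mul_apply, inv_mul_cancel] at this

/-- For each root only the nearest walls on either side of `u` matter. Ceiling minus one and floor
plus one skip a wall through `u` itself. -/
lemma openStar_eq_preimage (u : V) : openStar P u = ⋂ i, P.root' i ⁻¹'
    Ioo (2 * Real.pi * (⌈P.root' i u / (2 * Real.pi)⌉ - 1))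
      (2 * Real.pi * (⌊P.root' i u / (2 * Real.pi)⌋ + 1)) := by
  have hπ := Real.two_pi_pos
  ext x
  simp only [openStar, mem_ofPred_eq, mem_iInter, mem_preimage, mem_Ioo]
  refine forall_congr' fun i ↦ ⟨fun h ↦ ⟨?_, ?_⟩, fun ⟨h₁, h₂⟩ m hm ↦ ?_⟩
  · have h₁ : 2 * Real.pi * (⌈P.root' i u / (2 * Real.pi)⌉ - 1) < P.root' i u := by
      rw [mul_comm, ← lt_div_iff₀ hπ]
      linarith [Int.ceil_lt_add_one (P.root' i u / (2 * Real.pi))]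
    have h₂ := h (⌈P.root' i u / (2 * Real.pi)⌉ - 1) (by push_cast; linarith)
    push_cast at h₂
    have := pos_of_mul_pos_left h₂ (by linarith)
    linarith
  · have h₁ : P.root' i u < 2 * Real.pi * (⌊P.root' i u / (2 * Real.pi)⌋ + 1) := by
      rw [mul_comm, ← div_lt_iff₀ hπ]
      exact Int.lt_floor_add_one _
    have h₂ := h (⌊P.root' i u / (2 * Real.pi)⌋ + 1) (by push_cast; linarith)
    push_cast at h₂
    have := neg_of_mul_pos_left h₂ (by linarith)
    linarith
  · rcases lt_or_gt_of_ne hm with hm | hm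
    · refine mul_pos_of_neg_of_neg ?_ hm
      have h₃ : ⌊P.root' i u / (2 * Real.pi)⌋ < m := by
        rw [Int.floor_lt, div_lt_iff₀ hπ]
        linarith
      have h₄ : (⌊P.root' i u / (2 * Real.pi)⌋ + 1 : ℝ) ≤ m := by exact_mod_cast h₃
      nlinarith
    · refine mul_pos ?_ hm
      have h₃ : m < ⌈P.root' i u / (2 * Real.pi)⌉ := by
        rw [Int.lt_ceil, lt_div_iff₀ hπ]
        linarith
      have h₄ : (m : ℝ) ≤ ⌈P.root' i u / (2 * Real.pi)⌉ - 1 := by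
        have : (m + 1 : ℝ) ≤ ⌈P.root' i u / (2 * Real.pi)⌉ := by exact_mod_cast h₃
        linarith
      nlinarith

lemma convex_openStar (u : V) : Convex ℝ (openStar P u) := by
  rw [openStar_eq_preimage]
  exact convex_iInter fun i ↦ (convex_Ioo _ _).linear_preimage _

lemma isOpen_openStar [Finite ι] [TopologicalSpace V] (hP : ∀ i, Continuous (P.root' i)) (u : V) :
    IsOpen (openStar P u) := by
  rw [openStar_eq_preimage]
  exact isOpen_iInter_of_finite fun i ↦ isOpen_Ioo.preimage (hP i)

/-! ### Minimizing the distance to a point of the alcove -/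

/-- The form sums over all roots, and a reflection only permutes the summands. -/
lemma corootForm_coreflection [Fintype ι] (i : ι) (x y : V) :
    P.CorootForm (P.coreflection i x) (P.coreflection i y) = P.CorootForm x y := by
  have h (j : ι) (z : V) : P.root' j (P.coreflection i z) = P.root' (P.reflectionPerm i j) z := by
    simp [root'_reflectionPerm, P.coreflection_apply, mul_comm]
  simp only [P.corootForm_apply_apply, h]
  exact Equiv.sum_comp (P.reflectionPerm i) fun j ↦ P.root' j x * P.root' j y

lemma corootForm_comm [Fintype ι] (x y : V) : P.CorootForm x y = P.CorootForm y x := by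
  simp only [P.corootForm_apply_apply, mul_comm]

lemma two_mul_corootForm_coroot [Fintype ι] (i : ι) (x : V) :
    2 * P.CorootForm x (P.coroot i) =
      P.root' i x * P.CorootForm (P.coroot i) (P.coroot i) := by
  have h := corootForm_coreflection (P := P) i x (P.coroot i)
  rw [P.coreflection_apply_self, P.coreflection_apply] at h
  simp only [map_sub, map_neg, map_smul, LinearMap.sub_apply, LinearMap.smul_apply,
    smul_eq_mul] at h
  linarith

lemma corootForm_coroot_pos [Fintype ι] (i : ι) :
    0 < P.CorootForm (P.coroot i) (P.coroot i) := by
  rw [P.corootForm_apply_apply]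
  refine Finset.sum_pos' (fun j _ ↦ mul_self_nonneg _) ⟨i, Finset.mem_univ _, ?_⟩
  rw [P.root'_coroot_eq_pairing, P.pairing_same]
  norm_num

/-- The squared distance to `c` drops under the reflection exactly when the wall separates `y` from
`c`. -/
lemma corootForm_affineReflection_sub [Fintype ι] (i : ι) (m : ℤ) (y c : V) :
    P.CorootForm (affineReflection P i m y - c) (affineReflection P i m y - c) =
      P.CorootForm (y - c) (y - c) + (P.root' i y - 2 * Real.pi * m) *
        (P.root' i c - 2 * Real.pi * m) * P.CorootForm (P.coroot i) (P.coroot i) := by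
  have h₁ := two_mul_corootForm_coroot (P := P) i (y - c)
  have h₂ := corootForm_comm (P := P) (P.coroot i) (y - c)
  rw [affineReflection_apply, sub_right_comm]
  simp only [map_sub (P.CorootForm), map_smul, LinearMap.sub_apply, LinearMap.smul_apply,
    smul_eq_mul, map_sub _ (y - c)] at h₁ h₂ ⊢
  rw [map_sub (P.root' i)] at h₁
  linear_combination -(P.root' i y - 2 * Real.pi * m) * h₁ -
    (P.root' i y - 2 * Real.pi * m) * h₂

/-- When `g` fixes `u`, each root value at `g x` is determined by the root `j` to which `g` pulls it
back, leaving finitely many choices; the constants `2πn` cancel. -/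
lemma finite_orbit [Finite ι] {u : V} (hsep : ∀ x y : V, (∀ i, P.root' i x = P.root' i y) → x = y)
    (x : V) : {y | ∃ g : V ≃ᵃ[ℝ] V, PermutesAffineRoots P g ∧ g u = u ∧ g x = y}.Finite := by
  refine Set.Finite.of_finite_image (f := fun y i ↦ P.root' i y) ?_
    fun y _ z _ h ↦ hsep y z fun i ↦ congrFun h i
  refine (Set.Finite.pi' fun i ↦ finite_range
    fun j ↦ P.root' i u + (P.root' j x - P.root' j u)).subset ?_
  rintro _ ⟨_, ⟨g, hg, hu, rfl⟩, rfl⟩ i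
  obtain ⟨j, n, h, -⟩ := hg i 0
  refine ⟨j, ?_⟩
  have h₁ := h x
  have h₂ := h u
  rw [hu] at h₂
  dsimp only
  linarith

/-- A point can be moved, by an element of the affine Weyl group that fixes `u`, to the same side
as `c` of all walls through `u`. -/
lemma exists_apply_same_side [Finite ι]
    (hP : ∀ w ∈ affineWeylGroup P, PermutesAffineRoots P w)
    (hsep : ∀ x y : V, (∀ i, P.root' i x = P.root' i y) → x = y) (u c x : V) :
    ∃ w ∈ affineWeylGroup P, w u = u ∧ ∀ (i : ι) (m : ℤ), P.root' i u = 2 * Real.pi * m →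
      0 ≤ (P.root' i (w x) - 2 * Real.pi * m) * (P.root' i c - 2 * Real.pi * m) := by
  have := Fintype.ofFinite ι
  have hfin : {y | ∃ w ∈ affineWeylGroup P, w u = u ∧ w x = y}.Finite :=
    (finite_orbit (u := u) hsep x).subset fun y ⟨w, hw, h⟩ ↦ ⟨w, hP w hw, h⟩
  obtain ⟨_, ⟨w, hw, hwu, rfl⟩, hmin⟩ := exists_min_image _
    (fun y ↦ P.CorootForm (y - c) (y - c)) hfin ⟨x, 1, one_mem _, rfl, rfl⟩
  refine ⟨w, hw, hwu, fun i m h ↦ ?_⟩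
  have := hmin (affineReflection P i m (w x)) ⟨affineReflection P i m * w,
    mul_mem (affineReflection_mem i m) hw, by simp [affineEquiv_mul_apply, hwu, h], rfl⟩
  rw [corootForm_affineReflection_sub] at this
  exact nonneg_of_mul_nonneg_left (by linarith) (corootForm_coroot_pos i)

/-! ### The closed fundamental alcove and its vertices -/

lemma closure_fundamentalAlcove [TopologicalSpace V] [IsTopologicalAddGroup V]
    [ContinuousSMul ℝ V] (hP : ∀ i, Continuous (P.root' i)) {b : P.Base} {θ : ι}
    (hθ : IsHighestRoot b θ) (hne : (fundamentalAlcove b).Nonempty) :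
    closure (fundamentalAlcove b) =
      {x | (∀ j ∈ b.support, 0 ≤ P.root' j x) ∧ P.root' θ x ≤ 2 * Real.pi} := by
  refine Subset.antisymm (closure_minimal (fun x hx ↦ ?_) ?_) fun x hx ↦ ?_
  · obtain ⟨h₁, h₂⟩ := hθ.mem_fundamentalAlcove_iff.1 hx
    exact ⟨fun j hj ↦ (h₁ j hj).le, h₂.le⟩
  · rw [ofPred_and]
    simp only [ofPred_forall]
    exact (isClosed_biInter fun j _ ↦ isClosed_le continuous_const (hP j)).inter
      (isClosed_le (hP θ) continuous_const)
  · obtain ⟨c, hc⟩ := hne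
    obtain ⟨hc₁, hc₂⟩ := hθ.mem_fundamentalAlcove_iff.1 hc
    refine closure_mono ?_ (segment_subset_closure_openSegment (left_mem_segment ℝ x c))
    rintro _ ⟨s, t, hs, ht, hst, rfl⟩
    refine hθ.mem_fundamentalAlcove_iff.2 ⟨fun j hj ↦ ?_, ?_⟩
    · rw [map_add, map_smul, map_smul, smul_eq_mul, smul_eq_mul]
      exact add_pos_of_nonneg_of_pos (mul_nonneg hs.le (hx.1 j hj)) (mul_pos ht (hc₁ j hj))
    · rw [map_add, map_smul, map_smul, smul_eq_mul, smul_eq_mul]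
      calc _ < s * (2 * Real.pi) + t * (2 * Real.pi) :=
            add_lt_add_of_le_of_lt (mul_le_mul_of_nonneg_left hx.2 hs.le)
              (mul_lt_mul_of_pos_left hc₂ ht)
        _ = 2 * Real.pi := by rw [← add_mul, hst, one_mul]

namespace IsVertices

variable {b : P.Base} {θ : ι} {v : Option b.support → V}

/-- Otherwise all simple roots, hence also the highest one, would be nonnegative at `-v (some k)`.
-/
lemma root'_self_pos (hv : IsVertices b θ v) (hθ : IsHighestRoot b θ) (k : b.support) :
    0 < P.root' k (v (some k)) := by
  by_contra! h
  have h₁ : 0 ≤ P.root' θ (-v (some k)) :=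
    toLinearMap_apply_nonneg hθ.root_mem fun j hj ↦ by
      rw [map_neg]
      rcases eq_or_ne ⟨j, hj⟩ k with rfl | hjk
      · simpa using h
      · rw [hv.simple k ⟨j, hj⟩ hjk, neg_zero]
  rw [map_neg, hv.highest] at h₁
  linarith [Real.pi_pos]

lemma root'_nonneg (hv : IsVertices b θ v) (hθ : IsHighestRoot b θ) (k : Option b.support)
    (j : ι) (hj : j ∈ b.support) : 0 ≤ P.root' j (v k) := by
  rcases k with _ | k
  · rw [hv.zero, map_zero]
  · rcases eq_or_ne ⟨j, hj⟩ k with rfl | hjk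
    · exact (hv.root'_self_pos hθ ⟨j, hj⟩).le
    · exact (hv.simple k ⟨j, hj⟩ hjk).ge

lemma root'_highest_le (hv : IsVertices b θ v) (k : Option b.support) :
    P.root' θ (v k) ≤ 2 * Real.pi := by
  rcases k with _ | k
  · rw [hv.zero, map_zero]
    exact Real.two_pi_pos.le
  · exact (hv.highest k).le

/-- The barycenter of the vertices lies in the fundamental alcove. -/
lemma nonempty_fundamentalAlcove (hv : IsVertices b θ v) (hθ : IsHighestRoot b θ) :
    (fundamentalAlcove b).Nonempty := by
  classical
  have hN : (0 : ℝ) < Fintype.card (Option b.support) := by exact_mod_cast Fintype.card_pos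
  refine ⟨(Fintype.card (Option b.support) : ℝ)⁻¹ • ∑ k, v k,
    hθ.mem_fundamentalAlcove_iff.2 ⟨fun j hj ↦ ?_, ?_⟩⟩
  · rw [map_smul, map_sum, smul_eq_mul]
    exact mul_pos (inv_pos.2 hN) (Finset.sum_pos' (fun k _ ↦ hv.root'_nonneg hθ k j hj)
      ⟨some ⟨j, hj⟩, Finset.mem_univ _, hv.root'_self_pos hθ ⟨j, hj⟩⟩)
  · rw [map_smul, map_sum, smul_eq_mul, inv_mul_lt_iff₀ hN, ← nsmul_eq_mul, ← Finset.card_univ,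
      ← Finset.sum_const]
    refine Finset.sum_lt_sum (fun k _ ↦ hv.root'_highest_le k) ⟨none, Finset.mem_univ _, ?_⟩
    rw [hv.zero, map_zero]
    exact Real.two_pi_pos

end IsVertices

lemma toLinearMap_apply_pos_of_ne_zero {b : P.Base} {a : M}
    (ha : a ∈ AddSubmonoid.closure (P.root '' b.support)) {u x : V}
    (hx : ∀ j ∈ b.support, 0 ≤ P.root' j x)
    (h : ∀ j ∈ b.support, P.root' j u ≠ 0 → 0 < P.root' j x) (hau : P.toLinearMap a u ≠ 0) :
    0 < P.toLinearMap a x := by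
  induction ha using AddSubmonoid.closure_induction with
  | mem a ha =>
    obtain ⟨j, hj, rfl⟩ := ha
    exact h j hj hau
  | zero => simp at hau
  | add a a' ha ha' h₁ h₂ =>
    rw [map_add, LinearMap.add_apply] at hau ⊢
    by_cases h₀ : P.toLinearMap a u = 0
    · rw [h₀, zero_add] at hau
      exact add_pos_of_nonneg_of_pos (toLinearMap_apply_nonneg ha hx) (h₂ hau)
    · exact add_pos_of_pos_of_nonneg (h₁ h₀) (toLinearMap_apply_nonneg ha' hx)

/-- A point of the closed alcove lies in the open star of `u` as soon as all walls of the alcove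
that contain it also contain `u`. -/
lemma mem_openStar_of_mem_closedAlcove {b : P.Base} {θ : ι} (hθ : IsHighestRoot b θ) {u x : V}
    (hu : ∀ j ∈ b.support, 0 ≤ P.root' j u) (hx : ∀ j ∈ b.support, 0 ≤ P.root' j x)
    (hθu : P.root' θ u ≤ 2 * Real.pi) (hθx : P.root' θ x ≤ 2 * Real.pi)
    (h : ∀ j ∈ b.support, P.root' j u ≠ 0 → 0 < P.root' j x)
    (h' : P.root' θ u ≠ 2 * Real.pi → P.root' θ x < 2 * Real.pi) : x ∈ openStar P u := by
  have hπ := Real.pi_pos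
  intro i m him
  wlog hi : P.root i ∈ AddSubmonoid.closure (P.root '' b.support) generalizing i m
  · have := this (P.reflectionPerm i i) (-m) (by
      rw [root'_reflectionPerm_self]
      push_cast
      contrapose! him
      linarith) ((root_mem_or_reflectionPerm_mem b i).resolve_left hi)
    rw [root'_reflectionPerm_self, root'_reflectionPerm_self] at this
    push_cast at this
    linarith
  have hiu : 0 ≤ P.root' i u := toLinearMap_apply_nonneg hi hu
  have hix : 0 ≤ P.root' i x := toLinearMap_apply_nonneg hi hx
  have hiu' := hθ.le hu i
  have hix' := hθ.le hx i
  rcases lt_trichotomy m 0 with hm | rfl | hm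
  · have : (m : ℝ) ≤ -1 := by exact_mod_cast Int.le_sub_one_of_lt hm
    exact mul_pos (by nlinarith) (by nlinarith)
  · rw [Int.cast_zero, mul_zero, sub_zero] at him ⊢
    rw [sub_zero]
    exact mul_pos (toLinearMap_apply_pos_of_ne_zero hi hx h him)
      (lt_of_le_of_ne hiu him.symm)
  · rcases (show 1 ≤ m from hm).eq_or_lt with rfl | hm
    · rw [Int.cast_one, mul_one] at him ⊢
      refine mul_pos_of_neg_of_neg ?_ (lt_of_le_of_ne (by linarith) him)
      -- If `u` lies on the wall of `θ`, then `θ - α` is nonzero at `u`, hence positive at `x`, and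
      -- `α(x) < θ(x) ≤ 2π`. Otherwise `θ(x) < 2π` already.
      by_cases hθu' : P.root' θ u = 2 * Real.pi
      · have := toLinearMap_apply_pos_of_ne_zero (hθ i) hx h (by
          rw [map_sub, LinearMap.sub_apply]
          change P.root' θ u - P.root' i u ≠ 0
          contrapose! him
          linarith)
        rw [map_sub, LinearMap.sub_apply] at this
        change 0 < P.root' θ x - P.root' i x at this
        linarith
      · linarith [h' hθu']
    · have : (2 : ℝ) ≤ m := by exact_mod_cast hm
      exact mul_pos_of_neg_of_neg (by nlinarith) (by nlinarith)

lemma mem_openStar_of_notMem_face {b : P.Base} {θ : ι} (hθ : IsHighestRoot b θ)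
    {v : Option b.support → V} (hv : IsVertices b θ v) (k : Option b.support) {x : V}
    (hx : ∀ j ∈ b.support, 0 ≤ P.root' j x) (hθx : P.root' θ x ≤ 2 * Real.pi)
    (hk : x ∉ face b θ k) : x ∈ openStar P (v k) := by
  refine mem_openStar_of_mem_closedAlcove hθ (hv.root'_nonneg hθ k) hx (hv.root'_highest_le k)
    hθx (fun j hj hjk ↦ ?_) fun h ↦ ?_
  · rcases k with _ | k
    · simp [hv.zero] at hjk
    · obtain rfl : ⟨j, hj⟩ = k := by
        by_contra h
        exact hjk (hv.simple k ⟨j, hj⟩ h)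
      exact (hx j hj).lt_of_ne' fun h ↦ hk ⟨hθx, fun i hi _ ↦ hx i hi, h⟩
  · rcases k with _ | k
    · exact hθx.lt_of_ne fun h ↦ hk ⟨h, hx⟩
    · exact absurd (hv.highest k) h

lemma notMem_face_of_mem_openStar {b : P.Base} {θ : ι} (hθ : IsHighestRoot b θ)
    {v : Option b.support → V} (hv : IsVertices b θ v) (k : Option b.support) {x : V}
    (hx : x ∈ openStar P (v k)) : x ∉ face b θ k := by
  intro h
  rcases k with _ | k
  · have := hx θ 1 (by simp [hv.zero, Real.pi_ne_zero])
    simp [h.1] at this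
  · have := hx k 0 (by simpa using (hv.root'_self_pos hθ k).ne')
    simp [h.2.2] at this

/-! ### The cells -/

/-- The image of an interior point lies on no wall, hence not on the boundary of the alcove. -/
lemma mem_fundamentalAlcove_of_permutesAffineRoots [TopologicalSpace V]
    [IsTopologicalAddGroup V] [ContinuousSMul ℝ V] (hP : ∀ i, Continuous (P.root' i))
    {b : P.Base} {θ : ι} (hθ : IsHighestRoot b θ) {g : V ≃ᵃ[ℝ] V} (hg : PermutesAffineRoots P g) {x : V}
    (hx : x ∈ fundamentalAlcove b) (hgx : g x ∈ closure (fundamentalAlcove b)) :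
    g x ∈ fundamentalAlcove b := by
  have hne (i : ι) (m : ℤ) : P.root' i (g x) - 2 * Real.pi * m ≠ 0 := by
    obtain ⟨j, n, h, -⟩ := hg i m
    rw [h]
    exact sub_ne_zero_of_mem_fundamentalAlcove hx j n
  rw [closure_fundamentalAlcove hP hθ ⟨x, hx⟩] at hgx
  refine hθ.mem_fundamentalAlcove_iff.2 ⟨fun j hj ↦ (hgx.1 j hj).lt_of_ne' ?_, hgx.2.lt_of_ne ?_⟩
  · simpa using hne j 0
  · simpa [sub_ne_zero] using hne θ 1

lemma closure_fundamentalAlcove_subset_iUnion_cell [TopologicalSpace V] {b : P.Base}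
    {θ : ι} {v : Option b.support → V} (hθ : IsHighestRoot b θ) :
    closure (fundamentalAlcove b) ⊆ ⋃ k, cell b θ v k := by
  intro x hx
  suffices ∃ k, x ∉ face b θ k by
    obtain ⟨k, hk⟩ := this
    exact mem_iUnion.2 ⟨k, mem_iUnion₂.2 ⟨1, ⟨one_mem _, rfl⟩, x, ⟨hx, hk⟩, rfl⟩⟩
  by_contra! h
  have h₁ : 0 ≤ P.root' θ (-x) := toLinearMap_apply_nonneg hθ.root_mem fun j hj ↦ by
    rw [map_neg, (h (some ⟨j, hj⟩)).2.2, neg_zero]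
  rw [map_neg, (h none).1] at h₁
  linarith [Real.pi_pos]

section Topology

variable [TopologicalSpace V] [IsTopologicalAddGroup V] [ContinuousSMul ℝ V] [Finite ι]
  [P.IsCrystallographic] [P.IsReduced] {b : P.Base} {θ : ι} {v : Option b.support → V}

/-- The cell of a vertex is its open star. -/
lemma cell_eq_openStar (hP : ∀ i, Continuous (P.root' i))
    (hsep : ∀ x y : V, (∀ i, P.root' i x = P.root' i y) → x = y) (hθ : IsHighestRoot b θ)
    (hv : IsVertices b θ v) (k : Option b.support) : cell b θ v k = openStar P (v k) := by
  have hne := hv.nonempty_fundamentalAlcove hθ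
  obtain ⟨c, hc⟩ := hne
  obtain ⟨hc₁, hc₂⟩ := hθ.mem_fundamentalAlcove_iff.1 hc
  have hperm (w) (hw : w ∈ affineWeylGroup P) : PermutesAffineRoots P w :=
    permutesAffineRoots_of_mem hθ hc₁ hw
  refine Subset.antisymm (iUnion₂_subset ?_) fun x hx ↦ ?_
  · rintro w ⟨hw, hwk⟩ _ ⟨x, ⟨hx, hxk⟩, rfl⟩
    rw [closure_fundamentalAlcove hP hθ ⟨c, hc⟩] at hx
    have := mem_openStar_of_notMem_face hθ hv k hx.1 hx.2 hxk
    rwa [← hwk, apply_mem_openStar_iff (hperm w hw) (hperm _ (inv_mem hw))]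
  -- After folding, each alcove inequality for `w x` follows from being on the side of `c` if the
  -- wall contains `v k`, and from the open star if it does not.
  · obtain ⟨w, hw, hwk, h⟩ := exists_apply_same_side hperm hsep (v k) c x
    have hwx : w x ∈ openStar P (v k) := by
      have := (apply_mem_openStar_iff (hperm w hw) (hperm _ (inv_mem hw))).2 hx
      rwa [hwk] at this
    have hw' : w⁻¹ (v k) = v k := by
      conv_lhs => rw [← hwk]
      rw [← affineEquiv_mul_apply, inv_mul_cancel, AffineEquiv.coe_one, id]
    refine mem_iUnion₂.2 ⟨w⁻¹, ⟨inv_mem hw, hw'⟩, w x, ⟨?_, notMem_face_of_mem_openStar hθ hv k hwx⟩,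
      by rw [← affineEquiv_mul_apply, inv_mul_cancel, AffineEquiv.coe_one, id]⟩
    rw [closure_fundamentalAlcove hP hθ ⟨c, hc⟩]
    refine ⟨fun j hj ↦ ?_, ?_⟩
    · by_cases hjk : P.root' j (v k) = 0
      · have := h j 0 (by simpa using hjk)
        rw [Int.cast_zero, mul_zero, sub_zero, sub_zero] at this
        exact nonneg_of_mul_nonneg_left this (hc₁ j hj)
      · have := hwx j 0 (by simpa using hjk)
        rw [Int.cast_zero, mul_zero, sub_zero, sub_zero] at this
        exact (pos_of_mul_pos_left this (hv.root'_nonneg hθ k j hj)).le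
    · by_cases hθk : P.root' θ (v k) = 2 * Real.pi
      · have := h θ 1 (by simpa using hθk)
        rw [Int.cast_one, mul_one] at this
        nlinarith
      · have := hwx θ 1 (by rw [Int.cast_one, mul_one]; exact sub_ne_zero.2 hθk)
        rw [Int.cast_one, mul_one] at this
        have := neg_of_mul_pos_left this (by linarith [hv.root'_highest_le k])
        linarith

lemma apply_vertex_eq_of_mem_cell (hP : ∀ i, Continuous (P.root' i))
    (hsep : ∀ x y : V, (∀ i, P.root' i x = P.root' i y) → x = y) (hθ : IsHighestRoot b θ)
    (hv : IsVertices b θ v) {k : Option b.support} {u : V} (hu : u ∈ cell b θ v k)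
    {w : V ≃ᵃ[ℝ] V} (hw : w ∈ affineWeylGroup P) (hwu : w u ∈ cell b θ v k) : w (v k) = v k := by
  obtain ⟨c, hc⟩ := hv.nonempty_fundamentalAlcove hθ
  have hperm (w) (hw : w ∈ affineWeylGroup P) : PermutesAffineRoots P w :=
    permutesAffineRoots_of_mem hθ (hθ.mem_fundamentalAlcove_iff.1 hc).1 hw
  obtain ⟨g, ⟨hg, hgk⟩, a, ⟨ha, -⟩, rfl⟩ := mem_iUnion₂.1 hu
  rw [cell_eq_openStar hP hsep hθ hv] at hwu
  have hwg := mul_mem hw hg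
  -- the preimage of the open star under `w * g` is an open neighbourhood of `a`
  have hiff (y : V) : (w * g) y ∈ openStar P (v k) ↔ y ∈ openStar P ((w * g)⁻¹ (v k)) := by
    have := apply_mem_openStar_iff (hperm _ hwg) (hperm _ (inv_mem hwg))
      (u := (w * g)⁻¹ (v k)) (x := y)
    rwa [← affineEquiv_mul_apply _ _ (v k), mul_inv_cancel] at this
  -- Replacing `a` by an interior point `p` makes freeness applicable: `h⁻¹ * (w * g)` keeps `p` in
  -- the alcove, so `w * g = h` fixes `v k`, as does `g`.
  obtain ⟨p, hp, hpA⟩ := mem_closure_iff.1 ha _ (isOpen_openStar hP _) ((hiff a).1 hwu)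
  have hp' := (hiff p).2 hp
  rw [← cell_eq_openStar hP hsep hθ hv] at hp'
  obtain ⟨h, ⟨hh, hhk⟩, q, ⟨hq, -⟩, hqp⟩ := mem_iUnion₂.1 hp'
  have hmem : h⁻¹ * (w * g) ∈ affineWeylGroup P := mul_mem (inv_mem hh) hwg
  have hq' : (h⁻¹ * (w * g)) p = q := by
    rw [affineEquiv_mul_apply, ← hqp, ← affineEquiv_mul_apply, inv_mul_cancel]
    rfl
  have h₁ := mem_fundamentalAlcove_of_permutesAffineRoots hP hθ (hperm _ hmem) hpA (hq' ▸ hq)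
  have h₂ := eq_one_of_mem_fundamentalAlcove hθ hmem hpA h₁
  rw [inv_mul_eq_one] at h₂
  rw [h₂, affineEquiv_mul_apply, hgk] at hhk
  exact hhk

end Topology

end RootSystem

/-! ### The root system of a simple Lie algebra -/

section Lie

open LieAlgebra

variable {𝔤 : Type*} [LieRing 𝔤] [LieAlgebra ℂ 𝔤] [FiniteDimensional ℂ 𝔤] [IsSimple ℂ 𝔤]
  (𝔥 : LieSubalgebra ℂ 𝔤) [𝔥.IsCartanSubalgebra]

instance : (realRootSystem 𝔥).IsCrystallographic where
  exists_value i j := by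
    obtain ⟨z, hz⟩ :=
      RootPairing.IsValuedIn.exists_value (S := ℤ) (P := IsKilling.rootSystem 𝔥) i j
    refine ⟨z, FaithfulSMul.algebraMap_injective ℝ ℂ ?_⟩
    have := RootPairing.IsValuedIn.trans (IsKilling.rootSystem 𝔥) ℝ ℤ
    have h := RootPairing.restrictScalars_pairing (IsKilling.rootSystem 𝔥) ℝ i j
    rw [← IsScalarTower.algebraMap_apply, hz]
    exact h.symm

/-- A nontrivial real relation between two roots is also a nontrivial complex one. -/
instance : (realRootSystem 𝔥).IsReduced where
  eq_or_eq_neg i j h := by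
    have := RootPairing.IsReduced.eq_or_eq_neg (P := IsKilling.rootSystem 𝔥) i j ?_
    · exact this.imp Subtype.ext Subtype.ext
    · rw [LinearIndependent.pair_iff] at h ⊢
      push Not at h
      obtain ⟨s, t, h₁, h₂⟩ := h
      intro h₃
      obtain ⟨h₄, h₅⟩ := h₃ s t (congrArg Subtype.val h₁)
      exact h₂ (by exact_mod_cast h₄) (by exact_mod_cast h₅)

/-- The roots span the space in perfect duality with `realCartan 𝔥`, so they separate points. -/
lemma eq_of_forall_root'_eq {x y : realCartan 𝔥}
    (h : ∀ i, (realRootSystem 𝔥).root' i x = (realRootSystem 𝔥).root' i y) : x = y := by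
  set P := realRootSystem 𝔥
  refine P.toLinearMap.flip.toPerfPair.injective (LinearMap.ext_on_range
    (v := P.root) RootPairing.IsRootSystem.span_root_eq_top h)

end Lie

end AffineWeyl

theorem mainTheorem3 {𝔤 : Type*} [LieRing 𝔤] [LieAlgebra ℂ 𝔤] [FiniteDimensional ℂ 𝔤]
    [LieAlgebra.IsSimple ℂ 𝔤]
    [TopologicalSpace 𝔤] [IsTopologicalAddGroup 𝔤] [ContinuousSMul ℂ 𝔤] [T2Space 𝔤]
    (𝔥 : LieSubalgebra ℂ 𝔤) [𝔥.IsCartanSubalgebra]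
    (b : (AffineWeyl.realRootSystem 𝔥).Base)
    (θ : 𝔥.root) (hθ : AffineWeyl.IsHighestRoot b θ)
    (v : Option b.support → AffineWeyl.realCartan 𝔥) (hv : AffineWeyl.IsVertices b θ v) :
    (∀ k, IsOpen (AffineWeyl.cell b θ v k) ∧ v k ∈ AffineWeyl.cell b θ v k ∧
      StarConvex ℝ (v k) (AffineWeyl.cell b θ v k)) ∧
    (∀ k, ∀ (α : 𝔥.root) (m : ℤ),
      (AffineWeyl.wall (AffineWeyl.realRootSystem 𝔥) α m ∩ AffineWeyl.cell b θ v k).Nonempty →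
      v k ∈ AffineWeyl.wall (AffineWeyl.realRootSystem 𝔥) α m) ∧
    (∀ k, ∀ u₁ ∈ AffineWeyl.cell b θ v k, ∀ u₂ ∈ AffineWeyl.cell b θ v k,
      ∀ w ∈ AffineWeyl.affineWeylGroup (AffineWeyl.realRootSystem 𝔥), u₂ = w u₁ → w (v k) = v k) ∧
    closure (AffineWeyl.fundamentalAlcove b) ⊆ ⋃ k, AffineWeyl.cell b θ v k := by
  have : ContinuousSMul ℝ 𝔤 := IsScalarTower.continuousSMul ℂ
  have : IsTopologicalAddGroup 𝔥 := 
    inferInstanceAs (IsTopologicalAddGroup 𝔥.toSubmodule)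
  have : ContinuousSMul ℝ 𝔥 :=
    ⟨continuous_induced_rng.2 (continuous_fst.smul (continuous_subtype_val.comp continuous_snd))⟩
  have : IsTopologicalAddGroup (AffineWeyl.realCartan 𝔥) := inferInstance
  have : ContinuousSMul ℝ (AffineWeyl.realCartan 𝔥) := inferInstance
  have : FiniteDimensional ℝ (AffineWeyl.realCartan 𝔥) :=
    FiniteDimensional.span_of_finite ℝ (Set.finite_range _)
  have hP (i) : Continuous ((AffineWeyl.realRootSystem 𝔥).root' i) :=
    LinearMap.continuous_of_finiteDimensional _
  have hsep (x y : AffineWeyl.realCartan 𝔥) (h : ∀ i, (AffineWeyl.realRootSystem 𝔥).root' i x =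
    (AffineWeyl.realRootSystem 𝔥).root' i y) : x = y := AffineWeyl.eq_of_forall_root'_eq 𝔥 h
  have hcell := AffineWeyl.cell_eq_openStar hP hsep hθ hv
  refine ⟨fun k ↦ ?_, fun k α m ⟨x, hx, hxk⟩ ↦ ?_, fun k u hu _ hu' w hw h ↦ ?_,
    AffineWeyl.closure_fundamentalAlcove_subset_iUnion_cell hθ⟩
  · rw [hcell k]
    have hk := AffineWeyl.self_mem_openStar (P := AffineWeyl.realRootSystem 𝔥) (v k)
    exact ⟨AffineWeyl.isOpen_openStar hP _, hk, AffineWeyl.convex_openStar _ hk⟩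
  · by_contra h
    rw [hcell k] at hxk
    have h₁ := hxk α m (sub_ne_zero.2 h)
    rw [sub_eq_zero.2 hx, zero_mul] at h₁
    exact h₁.false
  · exact AffineWeyl.apply_vertex_eq_of_mem_cell hP hsep hθ hv hu hw (h ▸ hu')
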